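/- Call a non-negative Borel measure $\mu$ on $\mathbb{R}$ admissible if it has finite moments $s_k(\mu)=\int_{\mathbb{R}} x^k\,d\mu(x)$ of all orders $k\ge 0$ (with $x^0=1$). For $K\subseteq\mathbb{R}$ closed let $$\mathcal{M}(K)=\{(s_k(\mu))_{k\ge 0} : \mu \text{ admissible, supported on } K\},\qquad \mathcal{M}_n(K)=\{(s_0(\mu),\dots,s_n(\mu)) : \mu \text{ admissible, supported on } K\}.$$ A function $F:\mathbb{R}\to\mathbb{R}$ acts entrywise on finite and infinite real sequences; write $F[-]$ for this action. An absolutely monotonic entire function is an entire function whose Taylor coefficients at every point of $(0,\infty)$ are all real and non-negative. Let $F:\mathbb{R}\to\mathbb{R}$ and $u_0\in(0,1)$. The following are equivalent. (1) $F[-]$ maps $\mathcal{M}(\{-1,-u_0\})$ into $\mathcal{M}((-\infty,0])$, and maps $\mathcal{M}_4(\{-1,0\})\cup\bigcup_{u\in(0,1)}\mathcal{M}_4(\{-u\})$ into $\mathcal{M}_4((-\infty,0])$. (2) $F[-]$ maps $\mathcal{M}([-1,0])$ into itself. (3) There exists an absolutely monotonic entire function $\widetilde F$ such that $F(x)=\widetilde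 F(x)$ for $x>0$, $F(0)=0$, and $F(x)=-\widetilde F(-x)$ for $x<0$. Moreover, (3) is also equivalent to: $F[-]$ maps $\mathcal{M}([-1,0])$ into $\mathcal{M}((-\infty,0])$. Every $F$ as in (3) is odd, and there is an $F$ as in (3) that is discontinuous at $0$. -/

import Mathlib

open MeasureTheory Set

namespace MomentTransforms

/-- The admissible measures supported on `K`: (non-negative) Borel measures on `ℝ` having moments of
all orders (the order `0` makes them finite) and giving no mass to the complement of `K`.
For closed `K` the last condition says exactly that the topological support is contained in `K`. -/
def admissibleMeasures (K : Set ℝ) : Set (Measure ℝ) :=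
  {μ | (∀ k : ℕ, Integrable (fun x : ℝ => x ^ k) μ) ∧ μ Kᶜ = 0}

/-- The `k`-th moment of `μ`; here `x ^ 0 = 1`, also at `x = 0`. -/
noncomputable def moment (μ : Measure ℝ) (k : ℕ) : ℝ := ∫ x : ℝ, x ^ k ∂μ

/-- The set `𝓜(K)` of moment sequences of admissible measures supported on `K`. -/
def momentSeqs (K : Set ℝ) : Set (ℕ → ℝ) :=
  {s | ∃ μ ∈ admissibleMeasures K, ∀ k : ℕ, s k = moment μ k}

/-- The set `𝓜ₙ(K)` of truncated moment sequences `(s₀(μ), …, sₙ(μ))` of admissible measures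
supported on `K`. -/
def truncMomentSeqs (n : ℕ) (K : Set ℝ) : Set (Fin (n + 1) → ℝ) :=
  {s | ∃ μ ∈ admissibleMeasures K, ∀ k : Fin (n + 1), s k = moment μ (k : ℕ)}

/-- The entrywise action `F[-]` on finite or infinite sequences. -/
def entrywise {ι : Type*} (F : ℝ → ℝ) (s : ι → ℝ) : ι → ℝ := fun k => F (s k)

/-- Absolutely monotonic entire functions: entire functions all of whose Taylor coefficients at every
point of `(0, ∞)` are non-negative reals (equivalently, all derivatives are, as the Taylor
coefficient is the derivative divided by a factorial). -/
def AbsMonotonicEntire (G : ℂ → ℂ) : Prop :=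
  Differentiable ℂ G ∧
    ∀ x : ℝ, 0 < x → ∀ n : ℕ,
      0 ≤ (iteratedDeriv n G (x : ℂ)).re ∧ (iteratedDeriv n G (x : ℂ)).im = 0

/-- `F` is given by an absolutely monotonic entire function `G` on `(0, ∞)`, by `0` at `0`, and by
`x ↦ -G (-x)` on `(-∞, 0)`. -/
def IsOddAbsMonotonic (F : ℝ → ℝ) : Prop :=
  ∃ G : ℂ → ℂ, AbsMonotonicEntire G ∧
    (∀ x : ℝ, 0 < x → (F x : ℂ) = G (x : ℂ)) ∧
    F 0 = 0 ∧
    (∀ x : ℝ, x < 0 → (F x : ℂ) = -G (-(x : ℂ)))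

end MomentTransforms

/-!
Necessity: put the moments of `a δ₋₁ + b δ₋ᵤ` into `F`. The even ones give a positive sequence
`k ↦ F (a + b v ^ k)` with `v = u ^ 2`; pairing it with a non-negative polynomial that vanishes at
`v ^ m` for `m < n` but not at `v ^ n`, and letting `b → 0`, yields `0 ≤ F⁽ⁿ⁾ (a)` whenever `F` is
smooth. Mollification reduces a monotone `F` to this case, and Bernstein's theorem turns the signs
of the derivatives into a power series. The moments of `a δ₋₁ + b δ₀` up to order four force `F` to
be odd and monotone, by integrating `x ^ j (1 + x) ^ 2` for `j = 0, 1, 2`.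

Sufficiency: by oddness and reflection one may replace `(-∞, 0]` by `[0, ∞)`. If `ν` has moments
`s k`, then the law of a product of `m` independent copies of `ν` has moments `s k ^ m`, and these
laws can be summed against the power series of `F`.
-/

section

open Filter Topology Polynomial
open scoped ContDiff ComplexOrder Convolution Pointwise

namespace MomentTransforms

/-- On `(0, ∞)`, the function `f` is the sum of a power series with non-negative coefficients that
converges there. By `isOddAbsMonotonic_iff` this is the real-variable form of being the restriction
of an absolutely monotonic entire function. -/
def HasNonnegPowerSeries (f : ℝ → ℝ) : Prop :=
  ∃ c : ℕ → ℝ, (∀ m, 0 ≤ c m) ∧ ∀ x, 0 < x → HasSum (fun m => c m * x ^ m) (f x)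

theorem absMonotonicEntire_iff {G : ℂ → ℂ} :
    AbsMonotonicEntire G ↔ Differentiable ℂ G ∧ ∀ n, 0 ≤ iteratedDeriv n G 0 := by
  have nonneg_iff (z : ℂ) : 0 ≤ z ↔ 0 ≤ z.re ∧ z.im = 0 := by
    rw [Complex.le_def, Complex.zero_re, Complex.zero_im, eq_comm (a := (0 : ℝ))]
  refine and_congr_right fun hG => ⟨fun h n => ?_, fun h x hx n => ?_⟩
  · have hcont : Continuous fun x : ℝ => iteratedDeriv n G (x : ℂ) :=
      ((hG.contDiff (n := n)).continuous_iteratedDeriv n le_rfl).comp Complex.continuous_ofReal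
    have hlim := (hcont.tendsto 0).mono_left (nhdsWithin_le_nhds (s := Ioi 0))
    rw [Complex.ofReal_zero] at hlim
    refine ge_of_tendsto hlim ?_
    filter_upwards [self_mem_nhdsWithin] with x hx using (nonneg_iff _).2 (h x hx n)
  · have hderiv : Differentiable ℂ (iteratedDeriv n G) :=
      (hG.contDiff (n := n + 1)).differentiable_iteratedDeriv n (by exact_mod_cast n.lt_succ_self)
    rw [← nonneg_iff]
    refine hderiv.nonneg_of_iteratedDeriv_nonneg (c := 0) (z := x) (fun m => ?_)
      (Complex.zero_le_real.2 hx.le)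
    simpa only [iteratedDeriv_eq_iterate, Function.iterate_add_apply] using h (m + n)

theorem AbsMonotonicEntire.hasNonnegPowerSeries {G : ℂ → ℂ} (hG : AbsMonotonicEntire G) :
    HasNonnegPowerSeries fun x => (G x).re := by
  obtain ⟨hdiff, hnonneg⟩ := absMonotonicEntire_iff.1 hG
  refine ⟨fun m => (m.factorial : ℝ)⁻¹ * (iteratedDeriv m G 0).re,
    fun m => mul_nonneg (by positivity) (Complex.le_def.1 (hnonneg m)).1, fun x _ => ?_⟩
  refine (Complex.hasSum_re (Complex.hasSum_taylorSeries_of_entire hdiff 0 x)).congr_fun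
    fun m => ?_
  obtain ⟨r, hr⟩ : ∃ r : ℝ, iteratedDeriv m G 0 = r :=
    ⟨_, Complex.eq_re_of_ofReal_le (r := 0) (by exact_mod_cast hnonneg m)⟩
  simp only [hr, sub_zero, smul_eq_mul, Complex.ofReal_re]
  rw [← Complex.ofReal_pow, ← Complex.ofReal_mul, ← Complex.ofReal_natCast, ← Complex.ofReal_inv,
    Complex.re_ofReal_mul, Complex.ofReal_re]
  ring

theorem iteratedDeriv_zero_of_hasSum {G : ℂ → ℂ} {c : ℕ → ℂ}
    (h : ∀ z, HasSum (fun m => c m * z ^ m) (G z)) (n : ℕ) :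
    iteratedDeriv n G 0 = n.factorial * c n := by
  have hG : HasFPowerSeriesAt G (.ofScalars ℂ c) 0 :=
    hasFPowerSeriesAt_iff.2 (.of_forall fun z => by
      simpa [FormalMultilinearSeries.coeff_ofScalars, mul_comm] using h z)
  have hcoeff := congrArg (FormalMultilinearSeries.coeff · n)
    (hG.eq_formalMultilinearSeries hG.analyticAt.hasFPowerSeriesAt)
  simp only [FormalMultilinearSeries.coeff_ofScalars] at hcoeff
  rw [hcoeff, mul_div_cancel₀ _ (by exact_mod_cast n.factorial_ne_zero)]

theorem differentiable_tsum_mul_pow {c : ℕ → ℂ}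
    (hc : ∀ R : ℝ, 0 < R → Summable fun m => ‖c m‖ * R ^ m) :
    Differentiable ℂ fun z : ℂ => ∑' m, c m * z ^ m := by
  intro z
  have hz : z ∈ Metric.ball 0 (‖z‖ + 1) := by simp
  refine (Complex.differentiableOn_tsum_of_summable_norm (hc _ (by positivity : 0 < ‖z‖ + 1))
    (fun m => by fun_prop) Metric.isOpen_ball fun m w hw => ?_).differentiableAt
    (Metric.isOpen_ball.mem_nhds hz)
  rw [mem_ball_zero_iff] at hw
  rw [norm_mul, norm_pow]
  gcongr

theorem HasNonnegPowerSeries.exists_absMonotonicEntire {f : ℝ → ℝ} (hf : HasNonnegPowerSeries f) :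
    ∃ G : ℂ → ℂ, AbsMonotonicEntire G ∧ ∀ x : ℝ, 0 < x → (f x : ℂ) = G x := by
  obtain ⟨c, hc, hsum⟩ := hf
  have hnorm (R : ℝ) (hR : 0 < R) : Summable fun m => ‖(c m : ℂ)‖ * R ^ m := by
    simpa only [Complex.norm_of_nonneg (hc _)] using (hsum R hR).summable
  have hdiff := differentiable_tsum_mul_pow hnorm
  have hasSum (z : ℂ) : HasSum (fun m => (c m : ℂ) * z ^ m) (∑' m, (c m : ℂ) * z ^ m) := by
    refine (Summable.of_norm_bounded (hnorm (‖z‖ + 1) (by positivity)) fun m => ?_).hasSum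
    rw [norm_mul, norm_pow]
    gcongr
    linarith
  refine ⟨_, absMonotonicEntire_iff.2 ⟨hdiff, fun n => ?_⟩, fun x hx => ?_⟩
  · rw [iteratedDeriv_zero_of_hasSum hasSum]
    exact mul_nonneg (by positivity) (Complex.zero_le_real.2 (hc n))
  · rw [← (hsum x hx).tsum_eq]
    push_cast
    rfl

theorem HasNonnegPowerSeries.congr {f g : ℝ → ℝ} (hf : HasNonnegPowerSeries f)
    (h : EqOn f g (Ioi 0)) : HasNonnegPowerSeries g := by
  obtain ⟨c, hc, hsum⟩ := hf
  exact ⟨c, hc, fun x hx => h hx ▸ hsum x hx⟩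

theorem HasNonnegPowerSeries.nonneg {f : ℝ → ℝ} (hf : HasNonnegPowerSeries f) {x : ℝ}
    (hx : 0 < x) : 0 ≤ f x := by
  obtain ⟨c, hc, hsum⟩ := hf
  exact (hsum x hx).nonneg fun m => mul_nonneg (hc m) (by positivity)

theorem HasNonnegPowerSeries.continuousOn {f : ℝ → ℝ} (hf : HasNonnegPowerSeries f) :
    ContinuousOn f (Ioi 0) := by
  obtain ⟨G, hG, hfG⟩ := hf.exists_absMonotonicEntire
  have hcont : Continuous fun x : ℝ => (G x).re :=
    Complex.continuous_re.comp (hG.1.continuous.comp Complex.continuous_ofReal)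
  exact hcont.continuousOn.congr fun x hx => by simp only [← hfG x hx, Complex.ofReal_re]

theorem HasNonnegPowerSeries.of_tendsto {ι : Type*} {l : Filter ι} [l.NeBot] {g : ι → ℝ → ℝ}
    {f : ℝ → ℝ} (hg : ∀ i, HasNonnegPowerSeries (g i))
    (hlim : ∀ x, 0 < x → Tendsto (fun i => g i x) l (𝓝 (f x))) : HasNonnegPowerSeries f := by
  choose c hc hsum using hg
  set U : Ultrafilter ι := .of l
  have hU : (U : Filter ι) ≤ l := Ultrafilter.of_le l
  have hle (R : ℝ) (hR : 0 < R) : ∀ᶠ i in U, ∀ m, c i m * R ^ m ≤ f R + 1 := by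
    filter_upwards [hU ((hlim R hR).eventually_le_const (lt_add_one (f R)))] with i hi m
    exact (le_hasSum (hsum i R hR) m fun k _ => mul_nonneg (hc i k) (by positivity)).trans hi
  have hcoeff (m : ℕ) : ∃ d ∈ Icc 0 (f 1 + 1), Tendsto (c · m) U (𝓝 d) := by
    refine isCompact_Icc.ultrafilter_le_nhds (U.map (c · m)) (le_principal_iff.2 ?_)
    exact (hle 1 one_pos).mono fun i hi => ⟨hc i m, by simpa using hi m⟩
  choose d hd hcd using hcoeff
  refine ⟨d, fun m => (hd m).1, fun x hx => ?_⟩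
  have hgeom : Summable fun m : ℕ => (f (2 * x) + 1) * (1 / 2) ^ m :=
    summable_geometric_two.mul_left _
  have hbound : ∀ᶠ i in U, ∀ m, ‖c i m * x ^ m‖ ≤ (f (2 * x) + 1) * (1 / 2) ^ m := by
    filter_upwards [hle (2 * x) (by positivity)] with i hi m
    have hdilate : x ^ m = (2 * x) ^ m * (1 / 2) ^ m := by rw [← mul_pow]; ring_nf
    rw [Real.norm_of_nonneg (mul_nonneg (hc i m) (by positivity)), hdilate, ← mul_assoc]
    exact mul_le_mul_of_nonneg_right (hi m) (by positivity)
  have hterm (m : ℕ) : Tendsto (fun i => c i m * x ^ m) U (𝓝 (d m * x ^ m)) :=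
    (hcd m).mul_const _
  have hlim' : Tendsto (fun i => g i x) U (𝓝 (∑' m, d m * x ^ m)) := by
    simpa only [(hsum _ x hx).tsum_eq] using
      tendsto_tsum_of_dominated_convergence hgeom hterm hbound
  rw [← tendsto_nhds_unique hlim' ((hlim x hx).mono_left hU)]
  refine (hgeom.of_norm_bounded fun m => ?_).hasSum
  exact le_of_tendsto (hterm m).norm (hbound.mono fun i hi => hi m)

theorem isOddAbsMonotonic_iff {F : ℝ → ℝ} :
    IsOddAbsMonotonic F ↔ F.Odd ∧ HasNonnegPowerSeries F := by
  constructor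
  · rintro ⟨G, hG, hpos, hzero, hneg⟩
    refine ⟨fun x => ?_, hG.hasNonnegPowerSeries.congr fun x hx => by
      simp only [← hpos x hx, Complex.ofReal_re]⟩
    have odd_of_neg (x : ℝ) (hx : x < 0) : F x = -F (-x) := by
      have := hpos (-x) (neg_pos.2 hx)
      push_cast at this
      exact_mod_cast this ▸ hneg x hx
    rcases lt_trichotomy x 0 with hx | rfl | hx
    · rw [odd_of_neg x hx, neg_neg]
    · rw [neg_zero, hzero, neg_zero]
    · rw [odd_of_neg (-x) (neg_lt_zero.2 hx), neg_neg]
  · rintro ⟨hodd, hF⟩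
    obtain ⟨G, hG, hpos⟩ := hF.exists_absMonotonicEntire
    refine ⟨G, hG, hpos, hodd.map_zero, fun x hx => ?_⟩
    rw [← Complex.ofReal_neg, ← hpos (-x) (neg_pos.2 hx), hodd x, Complex.ofReal_neg, neg_neg]

theorem isOddAbsMonotonic_sign : IsOddAbsMonotonic Real.sign := by
  have hone : AbsMonotonicEntire 1 :=
    absMonotonicEntire_iff.2 ⟨differentiable_const 1, fun n => by
      rw [Pi.one_def, iteratedDeriv_const]; positivity⟩
  exact isOddAbsMonotonic_iff.2 ⟨fun _ => Real.sign_neg,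
    hone.hasNonnegPowerSeries.congr fun _ hx => (Real.sign_of_pos hx).symm⟩

theorem not_continuousAt_sign : ¬ ContinuousAt Real.sign 0 := by
  intro h
  have hlim : Tendsto Real.sign (𝓝[>] 0) (𝓝 1) := by
    refine tendsto_const_nhds.congr' ?_
    filter_upwards [self_mem_nhdsWithin] with x hx using (Real.sign_of_pos hx).symm
  have := tendsto_nhds_unique hlim (h.tendsto.mono_left nhdsWithin_le_nhds)
  simp at this

section Bernstein

variable {g : ℝ → ℝ} {a x y : ℝ}

theorem exists_taylor_lagrange_Ici (hg : ContDiffOn ℝ ∞ g (Ici a)) (hx : a ≤ x) (hxy : x < y)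
    (n : ℕ) : ∃ ξ ∈ Ioo x y,
      g y = ∑ m ∈ Finset.range (n + 1),
          iteratedDerivWithin m g (Ici a) x / m.factorial * (y - x) ^ m +
        iteratedDerivWithin (n + 1) g (Ici a) ξ / (n + 1).factorial * (y - x) ^ (n + 1) := by
  have hsub : Icc x y ⊆ Ici a := Icc_subset_Ici_self.trans (Ici_subset_Ici.2 hx)
  have hsmooth (m : ℕ) : ContDiffOn ℝ m g (Ici a) := hg.of_le (by exact_mod_cast le_top)
  have hderiv (m : ℕ) : EqOn (iteratedDerivWithin m g (Icc x y))
      (iteratedDerivWithin m g (Ici a)) (Icc x y) := fun z hz => by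
    rw [iteratedDerivWithin_eq_iteratedFDerivWithin, iteratedDerivWithin_eq_iteratedFDerivWithin,
      iteratedFDerivWithin_subset hsub (uniqueDiffOn_Icc hxy) (uniqueDiffOn_Ici a) (hsmooth m) hz]
  obtain ⟨ξ, hξ, h⟩ := taylor_mean_remainder_lagrange (f := g) (n := n) hxy.ne
    (by rw [uIcc_of_le hxy.le]; exact (hsmooth n).mono hsub)
    (by
      rw [uIcc_of_le hxy.le, uIoo_of_lt hxy]
      exact (((hsmooth (n + 1)).mono hsub).differentiableOn_iteratedDerivWithin
        (by exact_mod_cast n.lt_succ_self) (uniqueDiffOn_Icc hxy)).mono Ioo_subset_Icc_self)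
  rw [uIcc_of_le hxy.le, taylor_within_apply] at h
  rw [uIoo_of_lt hxy] at hξ
  refine ⟨ξ, hξ, ?_⟩
  rw [sub_eq_iff_eq_add'.1 h, hderiv (n + 1) (Ioo_subset_Icc_self hξ)]
  congr 1
  · refine Finset.sum_congr rfl fun m _ => ?_
    rw [hderiv m (left_mem_Icc.2 hxy.le), smul_eq_mul]
    ring
  · ring

theorem taylor_term_le_of_absolutelyMonotoneOn (hg : AbsolutelyMonotoneOn g (Ici a)) (hx : a ≤ x)
    (hxy : x < y) (n : ℕ) :
    iteratedDerivWithin n g (Ici a) x / n.factorial * (y - x) ^ n ≤ g y := by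
  obtain ⟨ξ, hξ, h⟩ := exists_taylor_lagrange_Ici hg.contDiffOn hx hxy n
  have hterm (m : ℕ) {z : ℝ} (hz : a ≤ z) :
      0 ≤ iteratedDerivWithin m g (Ici a) z / m.factorial * (y - x) ^ m := by
    have := hg.iteratedDerivWithin_nonneg (uniqueDiffOn_Ici a) m hz
    have := sub_pos.2 hxy
    positivity
  rw [h]
  exact (Finset.single_le_sum (fun m _ => hterm m hx) (Finset.self_mem_range_succ n)).trans
    (le_add_of_nonneg_right (hterm (n + 1) (hx.trans hξ.1.le)))

theorem hasSum_taylor_of_absolutelyMonotoneOn (hg : AbsolutelyMonotoneOn g (Ici a)) (hx : a < x) :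
    HasSum (fun m => iteratedDerivWithin m g (Ici a) a / m.factorial * (x - a) ^ m) (g x) := by
  have := sub_pos.2 hx
  have hderiv (n : ℕ) {z : ℝ} (hz : a ≤ z) : 0 ≤ iteratedDerivWithin n g (Ici a) z :=
    hg.iteratedDerivWithin_nonneg (uniqueDiffOn_Ici a) n hz
  rw [hasSum_iff_tendsto_nat_of_nonneg fun m => by have := hderiv m le_rfl; positivity,
    ← tendsto_add_atTop_iff_nat 1]
  -- Comparing the remainder at `ξ ∈ (a, x)` with the Taylor term of `g` at `x + 2 * (x - a)` based
  -- at `ξ` gains a factor `2⁻¹` per order.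
  have remainder_le (n : ℕ) {ξ : ℝ} (hξ : ξ ∈ Ioo a x) :
      iteratedDerivWithin n g (Ici a) ξ / n.factorial * (x - a) ^ n ≤
        g (x + 2 * (x - a)) * (1 / 2) ^ n := by
    have hd := hderiv n hξ.1.le
    calc iteratedDerivWithin n g (Ici a) ξ / n.factorial * (x - a) ^ n
        = iteratedDerivWithin n g (Ici a) ξ / n.factorial * (2 * (x - a)) ^ n * (1 / 2) ^ n := by
          rw [mul_assoc _ _ ((1 / 2 : ℝ) ^ n), ← mul_pow]
          ring_nf
      _ ≤ iteratedDerivWithin n g (Ici a) ξ / n.factorial * (x + 2 * (x - a) - ξ) ^ n *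
          (1 / 2) ^ n := by
          gcongr
          linarith [hξ.2]
      _ ≤ g (x + 2 * (x - a)) * (1 / 2) ^ n := by
          gcongr
          exact taylor_term_le_of_absolutelyMonotoneOn hg hξ.1.le (by linarith [hξ.2]) n
  have hlower : Tendsto (fun n : ℕ => g x - g (x + 2 * (x - a)) * (1 / 2) ^ (n + 1)) atTop
      (𝓝 (g x)) := by
    have hgeom : Tendsto (fun n : ℕ => (1 / 2 : ℝ) ^ (n + 1)) atTop (𝓝 0) :=
      (tendsto_pow_atTop_nhds_zero_of_lt_one (by norm_num) (by norm_num)).comp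
        (tendsto_add_atTop_nat 1)
    simpa using (hgeom.const_mul (g (x + 2 * (x - a)))).const_sub (g x)
  refine tendsto_of_tendsto_of_tendsto_of_le_of_le hlower tendsto_const_nhds (fun n => ?_)
    fun n => ?_ <;> dsimp only
  all_goals obtain ⟨ξ, hξ, h⟩ := exists_taylor_lagrange_Ici hg.contDiffOn le_rfl hx n
  · linarith [remainder_le (n + 1) hξ]
  · have := hderiv (n + 1) hξ.1.le
    have : 0 ≤ iteratedDerivWithin (n + 1) g (Ici a) ξ / (n + 1).factorial * (x - a) ^ (n + 1) := by
      positivity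
    linarith

theorem hasNonnegPowerSeries_of_absolutelyMonotoneOn (hg : AbsolutelyMonotoneOn g (Ici a)) :
    HasNonnegPowerSeries fun x => g (a + x) := by
  refine ⟨fun m => iteratedDerivWithin m g (Ici a) a / m.factorial, fun m => ?_, fun x hx => ?_⟩
  · have := hg.iteratedDerivWithin_nonneg (uniqueDiffOn_Ici a) m self_mem_Ici
    positivity
  · simpa only [add_sub_cancel_left] using
      hasSum_taylor_of_absolutelyMonotoneOn hg (lt_add_of_pos_right a hx)

end Bernstein

/-! ### Loewner's argument -/

/-- The Riesz functional of `s`: the linear functional on polynomials sending `X ^ k` to `s k`. -/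
noncomputable def riesz (s : ℕ → ℝ) (q : ℝ[X]) : ℝ := q.sum fun k c => c * s k

/-- Positivity of a sequence on polynomials that are non-negative on `ℝ`; by Hamburger's theorem
these are the moment sequences of measures on `ℝ`. -/
def IsPositiveSeq (s : ℕ → ℝ) : Prop := ∀ q : ℝ[X], (∀ x, 0 ≤ q.eval x) → 0 ≤ riesz s q

theorem iteratedDeriv_nonneg_of_forall_lt_eq_zero {f : ℝ → ℝ} {x₀ : ℝ} {n : ℕ}
    (hf : ContDiff ℝ n f) (hzero : ∀ m < n, iteratedDeriv m f x₀ = 0)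
    (hnonneg : ∀ᶠ x in 𝓝[>] x₀, 0 ≤ f x) : 0 ≤ iteratedDeriv n f x₀ := by
  have htaylor (x : ℝ) : taylorWithinEval f n univ x₀ x =
      (x - x₀) ^ n * (iteratedDeriv n f x₀ / n.factorial) := by
    rw [taylor_within_apply, Finset.sum_range_succ, Finset.sum_eq_zero fun m hm => by
      rw [iteratedDerivWithin_univ, hzero m (Finset.mem_range.1 hm), smul_zero]]
    rw [iteratedDerivWithin_univ, zero_add, smul_eq_mul]
    ring
  have hlim : Tendsto (fun x => f x / (x - x₀) ^ n) (𝓝[>] x₀)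
      (𝓝 (iteratedDeriv n f x₀ / n.factorial)) := by
    have h := ((Real.taylor_tendsto convex_univ (mem_univ x₀) hf.contDiffOn).mono_left
      (nhdsWithin_mono _ (subset_univ (Ioi x₀)))).add_const (iteratedDeriv n f x₀ / n.factorial)
    rw [zero_add] at h
    refine h.congr' ?_
    filter_upwards [self_mem_nhdsWithin] with x hx
    have : (x - x₀) ^ n ≠ 0 := pow_ne_zero n (sub_pos.2 hx).ne'
    rw [htaylor, sub_div, mul_div_cancel_left₀ _ this, sub_add_cancel]
  have hquot : 0 ≤ iteratedDeriv n f x₀ / n.factorial := by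
    refine ge_of_tendsto hlim ?_
    filter_upwards [hnonneg, self_mem_nhdsWithin] with x hfx hx
    exact div_nonneg hfx (pow_nonneg (sub_pos.2 hx).le n)
  rwa [le_div_iff₀ (by positivity), zero_mul] at hquot

theorem contDiff_riesz_comp {g : ℝ → ℝ} {n : ℕ} (hg : ContDiff ℝ n g) (a v : ℝ) (q : ℝ[X]) :
    ContDiff ℝ n fun b => riesz (fun k => g (a + b * v ^ k)) q :=
  ContDiff.sum fun _ _ => contDiff_const.mul (hg.comp (by fun_prop))

theorem iteratedDeriv_riesz_comp {g : ℝ → ℝ} {n : ℕ} (hg : ContDiff ℝ n g) (a v : ℝ) (q : ℝ[X]) :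
    iteratedDeriv n (fun b => riesz (fun k => g (a + b * v ^ k)) q) 0 =
      q.eval (v ^ n) * iteratedDeriv n g a := by
  have hterm (k : ℕ) : iteratedDeriv n (fun b => g (a + b * v ^ k)) 0 =
      (v ^ n) ^ k * iteratedDeriv n g a := by
    have hshift : ContDiff ℝ n fun z => g (a + z) := hg.comp (by fun_prop)
    have hscale := congrFun (iteratedDeriv_comp_const_mul hshift (v ^ k)) 0
    simp only [iteratedDeriv_comp_const_add, mul_zero, add_zero] at hscale
    simp only [mul_comm _ (v ^ k), hscale]
    ring
  simp only [riesz, Polynomial.sum_def]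
  have hsmooth (k : ℕ) : ContDiff ℝ n fun b => q.coeff k * g (a + b * v ^ k) :=
    contDiff_const.mul (hg.comp (by fun_prop))
  rw [iteratedDeriv_fun_sum fun k _ => (hsmooth k).contDiffAt]
  simp only [iteratedDeriv_const_mul_field, hterm, Polynomial.eval_eq_sum, Polynomial.sum_def,
    Finset.sum_mul, mul_assoc]

theorem exists_nonneg_polynomial_eval_pow {v : ℝ} (hv0 : 0 < v) (hv1 : v ≠ 1) (n : ℕ) :
    ∃ q : ℝ[X], (∀ x, 0 ≤ q.eval x) ∧ (∀ m < n, q.eval (v ^ m) = 0) ∧ 0 < q.eval (v ^ n) := by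
  refine ⟨(∏ m ∈ Finset.range n, (X - C (v ^ m))) ^ 2, fun x => ?_, fun m hm => ?_, ?_⟩
  · rw [eval_pow]
    exact sq_nonneg _
  · rw [eval_pow, eval_prod, Finset.prod_eq_zero (Finset.mem_range.2 hm) (by simp), sq, zero_mul]
  · rw [eval_pow, eval_prod]
    refine sq_pos_of_ne_zero (Finset.prod_ne_zero_iff.2 fun m hm => ?_)
    rw [eval_sub, eval_X, eval_C, sub_ne_zero]
    exact (pow_right_injective₀ hv0 hv1).ne (Finset.mem_range.1 hm).ne'

theorem iteratedDeriv_nonneg_of_isPositiveSeq {g : ℝ → ℝ} {n : ℕ} (hg : ContDiff ℝ n g) {a v : ℝ}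
    (hv0 : 0 < v) (hv1 : v ≠ 1)
    (h : ∀ b, 0 < b → IsPositiveSeq fun k => g (a + b * v ^ k)) : 0 ≤ iteratedDeriv n g a := by
  obtain ⟨q, hq, hqzero, hqpos⟩ := exists_nonneg_polynomial_eval_pow hv0 hv1 n
  have hriesz := iteratedDeriv_nonneg_of_forall_lt_eq_zero (contDiff_riesz_comp hg a v q)
    (fun m hm => by
      rw [iteratedDeriv_riesz_comp (hg.of_le (by exact_mod_cast hm.le)), hqzero m hm, zero_mul])
    (by filter_upwards [self_mem_nhdsWithin] with b hb using h b hb q hq)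
  rw [iteratedDeriv_riesz_comp hg] at hriesz
  exact nonneg_of_mul_nonneg_right hriesz hqpos

/-! ### Smoothing -/

section Smoothing

variable {f : ℝ → ℝ} (φ : ContDiffBump (0 : ℝ))

theorem contDiff_normed_convolution (hf : LocallyIntegrable f) :
    ContDiff ℝ ∞ (φ.normed volume ⋆ f) :=
  φ.hasCompactSupport_normed.contDiff_convolution_left (.lsmul ℝ ℝ) φ.contDiff_normed hf

theorem normed_convolution_mem_Icc (hf : Monotone f) (x : ℝ) :
    (φ.normed volume ⋆ f) x ∈ Icc (f (x - φ.rOut)) (f (x + φ.rOut)) := by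
  rw [Real.Icc_eq_closedBall, Metric.mem_closedBall]
  refine dist_convolution_le (by linarith [hf (by linarith [φ.rOut_pos] :
    x - φ.rOut ≤ x + φ.rOut)]) φ.support_normed_eq.subset φ.nonneg_normed φ.integral_normed
    hf.locallyIntegrable.aestronglyMeasurable fun y hy => ?_
  rw [← Metric.mem_closedBall, ← Real.Icc_eq_closedBall]
  rw [Real.ball_eq_Ioo] at hy
  exact ⟨hf hy.1.le, hf hy.2.le⟩

theorem IsPositiveSeq.normed_convolution (hf : LocallyIntegrable f) {p : ℕ → ℝ}
    (h : ∀ t ∈ Metric.ball 0 φ.rOut, IsPositiveSeq fun k => f (p k - t)) :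
    IsPositiveSeq fun k => (φ.normed volume ⋆ f) (p k) := by
  intro q hq
  have hint (x : ℝ) : Integrable fun t => φ.normed volume t * f (x - t) :=
    φ.hasCompactSupport_normed.convolutionExists_left (.lsmul ℝ ℝ) φ.continuous_normed hf x
  have hriesz : riesz (fun k => (φ.normed volume ⋆ f) (p k)) q =
      ∫ t, φ.normed volume t * riesz (fun k => f (p k - t)) q := by
    simp only [riesz, Polynomial.sum_def, Finset.mul_sum, mul_left_comm (φ.normed volume _)]
    rw [integral_finsetSum _ fun k _ => (hint (p k)).const_mul _]
    simp only [integral_const_mul, convolution_def, ContinuousLinearMap.lsmul_apply, smul_eq_mul]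
  rw [hriesz]
  refine integral_nonneg fun t => ?_
  by_cases ht : t ∈ Metric.ball 0 φ.rOut
  · exact mul_nonneg (φ.nonneg_normed t) (h t ht q hq)
  · rw [← φ.support_normed_eq (μ := volume), Function.notMem_support] at ht
    simp [ht]

end Smoothing

/-! ### Monotone functions preserving positivity -/

theorem eqOn_rightLim_of_continuousOn {f : ℝ → ℝ} (hf : Monotone f) {s : Set ℝ} (hs : IsOpen s)
    (hcont : ContinuousOn (Function.rightLim f) s) : EqOn (Function.rightLim f) f s := by
  intro x hx
  refine le_antisymm ?_ (hf.le_rightLim le_rfl)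
  have hleft : Tendsto (Function.rightLim f) (𝓝[<] x) (𝓝 (Function.rightLim f x)) :=
    (hcont.continuousAt (hs.mem_nhds hx)).tendsto.mono_left nhdsWithin_le_nhds
  refine le_of_tendsto hleft ?_
  filter_upwards [self_mem_nhdsWithin] with y hy using hf.rightLim_le hy

theorem hasNonnegPowerSeries_normed_convolution {f : ℝ → ℝ} (hf : LocallyIntegrable f) {v : ℝ}
    (hv0 : 0 < v) (hv1 : v ≠ 1)
    (h : ∀ a b, 0 < a → 0 < b → IsPositiveSeq fun k => f (a + b * v ^ k))
    (φ : ContDiffBump (0 : ℝ)) :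
    HasNonnegPowerSeries fun x => (φ.normed volume ⋆ f) (2 * φ.rOut + x) := by
  have hsmooth := contDiff_normed_convolution φ hf
  refine hasNonnegPowerSeries_of_absolutelyMonotoneOn <|
    .of_contDiff hsmooth fun n x hx => iteratedDeriv_nonneg_of_isPositiveSeq
      (hsmooth.of_le (by exact_mod_cast le_top)) hv0 hv1 fun b hb =>
        .normed_convolution φ hf fun t ht => ?_
  have hxt : 0 < x - t := by
    rw [Real.ball_eq_Ioo] at ht
    linarith [ht.2, φ.rOut_pos, mem_Ici.1 hx]
  simpa only [sub_add_eq_add_sub] using h (x - t) b hxt hb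

theorem hasNonnegPowerSeries_of_isPositiveSeq {f : ℝ → ℝ} (hf : Monotone f) {v : ℝ}
    (hv0 : 0 < v) (hv1 : v ≠ 1)
    (h : ∀ a b, 0 < a → 0 < b → IsPositiveSeq fun k => f (a + b * v ^ k)) :
    HasNonnegPowerSeries f := by
  obtain ⟨δ, -, hδ, hδlim⟩ := exists_seq_strictAnti_tendsto (0 : ℝ)
  let φ (n : ℕ) : ContDiffBump (0 : ℝ) := ⟨δ n / 2, δ n, half_pos (hδ n), half_lt_self (hδ n)⟩
  have hshift (x c : ℝ) (hc : 0 < c) :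
      Tendsto (fun n => f (x + c * δ n)) atTop (𝓝 (Function.rightLim f x)) := by
    refine (hf.tendsto_rightLim x).comp (tendsto_nhdsWithin_iff.2 ⟨?_, .of_forall fun n => ?_⟩)
    · simpa using (hδlim.const_mul c).const_add x
    · exact lt_add_of_pos_right x (mul_pos hc (hδ n))
  -- The shift by `2 * δ` makes the mollifications converge to the right limit at every point,
  -- whether or not `f` is known to be continuous there.
  have hlim (x : ℝ) : Tendsto (fun n => ((φ n).normed volume ⋆ f) (2 * (φ n).rOut + x)) atTop
      (𝓝 (Function.rightLim f x)) := by
    refine tendsto_of_tendsto_of_tendsto_of_le_of_le (hshift x 1 one_pos) (hshift x 3 three_pos)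
      (fun n => ?_) fun n => ?_
    · exact (hf (by simp only [φ]; linarith)).trans (normed_convolution_mem_Icc (φ n) hf _).1
    · exact (normed_convolution_mem_Icc (φ n) hf _).2.trans (hf (by simp only [φ]; linarith))
  have hright : HasNonnegPowerSeries (Function.rightLim f) :=
    .of_tendsto (fun n => hasNonnegPowerSeries_normed_convolution hf.locallyIntegrable hv0 hv1 h
      (φ n)) fun x _ => hlim x
  exact hright.congr (eqOn_rightLim_of_continuousOn hf isOpen_Ioi hright.continuousOn)

/-! ### Moment sequences -/

section Moments

variable {K L : Set ℝ} {μ ν : Measure ℝ} {F : ℝ → ℝ} {s t : ℕ → ℝ}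

theorem isFiniteMeasure_of_mem_admissibleMeasures (hμ : μ ∈ admissibleMeasures K) :
    IsFiniteMeasure μ := by
  have h := hμ.1 0
  simp only [pow_zero] at h
  exact (integrable_const_iff_isFiniteMeasure one_ne_zero).1 h

theorem ae_mem_of_mem_admissibleMeasures (hμ : μ ∈ admissibleMeasures K) : ∀ᵐ x ∂μ, x ∈ K :=
  mem_ae_iff.2 hμ.2

theorem moment_nonneg_of_subset_Ici (hμ : μ ∈ admissibleMeasures K) (hK : K ⊆ Ici 0) (k : ℕ) :
    0 ≤ moment μ k := by
  refine integral_nonneg_of_ae ?_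
  filter_upwards [ae_mem_of_mem_admissibleMeasures hμ] with x hx using pow_nonneg (hK hx) k

theorem momentSeqs_mono (h : K ⊆ L) : momentSeqs K ⊆ momentSeqs L :=
  fun _ ⟨μ, hμ, hs⟩ => ⟨μ, ⟨hμ.1, measure_mono_null (compl_subset_compl.2 h) hμ.2⟩, hs⟩

theorem truncMomentSeqs_eq_image (n : ℕ) (K : Set ℝ) :
    truncMomentSeqs n K = (fun s (k : Fin (n + 1)) => s k) '' momentSeqs K := by
  ext s
  constructor
  · rintro ⟨μ, hμ, hs⟩
    exact ⟨moment μ, ⟨μ, hμ, fun _ => rfl⟩, funext fun k => (hs k).symm⟩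
  · rintro ⟨t, ⟨μ, hμ, ht⟩, rfl⟩
    exact ⟨μ, hμ, fun k => ht k⟩

theorem truncMomentSeqs_mono (n : ℕ) (h : K ⊆ L) : truncMomentSeqs n K ⊆ truncMomentSeqs n L := by
  simpa only [truncMomentSeqs_eq_image] using image_mono (momentSeqs_mono h)

theorem mapsTo_truncMomentSeqs (h : MapsTo (entrywise F) (momentSeqs K) (momentSeqs L)) (n : ℕ) :
    MapsTo (entrywise F) (truncMomentSeqs n K) (truncMomentSeqs n L) := by
  simp only [truncMomentSeqs_eq_image, mapsTo_image_iff]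
  exact fun s hs => ⟨_, h hs, rfl⟩

theorem add_mem_momentSeqs (hs : s ∈ momentSeqs K) (ht : t ∈ momentSeqs K) :
    s + t ∈ momentSeqs K := by
  obtain ⟨μ, hμ, hsμ⟩ := hs
  obtain ⟨ν, hν, htν⟩ := ht
  refine ⟨μ + ν, ⟨fun k => (hμ.1 k).add_measure (hν.1 k), by simp [hμ.2, hν.2]⟩, fun k => ?_⟩
  rw [Pi.add_apply, hsμ, htν, moment, moment, moment, integral_add_measure (hμ.1 k) (hν.1 k)]

theorem const_mul_pow_mem_momentSeqs {x : ℝ} (hx : x ∈ K) {a : ℝ} (ha : 0 ≤ a) :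
    (fun k => a * x ^ k) ∈ momentSeqs K := by
  refine ⟨ENNReal.ofReal a • Measure.dirac x, ⟨fun k => ?_, ?_⟩, fun k => ?_⟩
  · exact (integrable_dirac (by simp)).smul_measure ENNReal.ofReal_ne_top
  · simp [Measure.dirac_apply, hx]
  · rw [moment, integral_smul_measure, integral_dirac, ENNReal.toReal_ofReal ha, smul_eq_mul]

theorem neg_one_pow_mul_mem_momentSeqs (hs : s ∈ momentSeqs K) :
    (fun k => (-1) ^ k * s k) ∈ momentSeqs (-K) := by
  obtain ⟨μ, hμ, hsμ⟩ := hs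
  refine ⟨μ.map (MeasurableEquiv.neg ℝ), ⟨fun k => ?_, ?_⟩, fun k => ?_⟩
  · rw [integrable_map_equiv]
    exact ((hμ.1 k).const_mul ((-1) ^ k)).congr (.of_forall fun x => (neg_pow x k).symm)
  · rw [MeasurableEquiv.map_apply]
    simpa using hμ.2
  · simp only [hsμ, moment, integral_map_equiv, ← integral_const_mul]
    exact integral_congr_ae (.of_forall fun x => (neg_pow x k).symm)

theorem mapsTo_momentSeqs_neg (hF : F.Odd)
    (h : MapsTo (entrywise F) (momentSeqs K) (momentSeqs L)) :
    MapsTo (entrywise F) (momentSeqs (-K)) (momentSeqs (-L)) := by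
  intro s hs
  have hmem := neg_one_pow_mul_mem_momentSeqs (h (neg_neg K ▸ neg_one_pow_mul_mem_momentSeqs hs))
  convert! hmem using 2 with k
  rcases neg_one_pow_eq_or ℝ k with hk | hk <;> simp [entrywise, hk, hF.eq]

/-! ### Products of independent random variables -/

/-- The law of the product of `n` independent random variables with law `ν` (when `ν` is a
probability measure); its moments are the `n`-th powers of those of `ν`. -/
noncomputable def mulPow (ν : Measure ℝ) (n : ℕ) : Measure ℝ :=
  (Measure.pi fun _ : Fin n => ν).map fun x => ∏ i, x i

theorem moment_mulPow (ν : Measure ℝ) [SigmaFinite ν] (n k : ℕ) :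
    moment (mulPow ν n) k = moment ν k ^ n := by
  rw [moment, mulPow, integral_map (by fun_prop) (by fun_prop)]
  simp only [← Finset.prod_pow]
  rw [integral_fintype_prod_eq_pow (fun x : ℝ => x ^ k), Fintype.card_fin, moment]

theorem mulPow_mem_admissibleMeasures {K : Submonoid ℝ} (hK : MeasurableSet (K : Set ℝ))
    (hν : ν ∈ admissibleMeasures K) (n : ℕ) : mulPow ν n ∈ admissibleMeasures K := by
  have := isFiniteMeasure_of_mem_admissibleMeasures hν
  constructor
  · intro k
    rw [mulPow, integrable_map_measure (by fun_prop) (by fun_prop)]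
    simp only [Function.comp_def, ← Finset.prod_pow]
    exact .fintype_prod fun _ => hν.1 k
  · have hmem : ∀ᵐ x : Fin n → ℝ ∂Measure.pi fun _ => ν, ∀ i, x i ∈ K :=
      ae_all_iff.2 fun i => (Measure.tendsto_eval_ae_ae (i := i)).eventually
        (ae_mem_of_mem_admissibleMeasures hν)
    rw [mulPow, ← mem_ae_iff]
    refine (ae_map_iff (by fun_prop) hK).2 ?_
    filter_upwards [hmem] with x hx using prod_mem fun i _ => hx i

theorem exists_hasSum_moment {K : Submonoid ℝ} (hK : MeasurableSet (K : Set ℝ))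
    (hK0 : (K : Set ℝ) ⊆ Ici 0) (hν : ν ∈ admissibleMeasures K) {c : ℕ → ℝ} (hc : ∀ m, 0 ≤ c m)
    (hsum : ∀ k, Summable fun m => c m * moment ν k ^ m) :
    ∃ σ ∈ admissibleMeasures K, ∀ k, HasSum (fun m => c m * moment ν k ^ m) (moment σ k) := by
  have := isFiniteMeasure_of_mem_admissibleMeasures hν
  have hpow := mulPow_mem_admissibleMeasures hK hν
  have hmoment (m k : ℕ) :
      ∫ x, x ^ k ∂(ENNReal.ofReal (c m) • mulPow ν m) = c m * moment ν k ^ m := by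
    rw [integral_smul_measure, ENNReal.toReal_ofReal (hc m), smul_eq_mul, ← moment_mulPow, moment]
  have hnorm (m k : ℕ) :
      ∫ x, ‖x ^ k‖ ∂(ENNReal.ofReal (c m) • mulPow ν m) = c m * moment ν k ^ m := by
    rw [← hmoment]
    refine integral_congr_ae (Measure.ae_smul_measure ?_ _)
    filter_upwards [ae_mem_of_mem_admissibleMeasures (hpow m)] with x hx
      using Real.norm_of_nonneg (pow_nonneg (hK0 hx) k)
  have hint (k : ℕ) : Integrable (fun x => x ^ k)
      (Measure.sum fun m => ENNReal.ofReal (c m) • mulPow ν m) :=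
    integrable_sum_measure (fun m => ((hpow m).1 k).smul_measure ENNReal.ofReal_ne_top)
      (by simpa only [hnorm] using hsum k)
  refine ⟨_, ⟨hint, ?_⟩, fun k => ?_⟩
  · rw [Measure.sum_apply _ hK.compl]
    simp [(hpow _).2]
  · exact (hasSum_integral_measure (hint k)).congr_fun fun m => (hmoment m k).symm

theorem moment_pos_or_eq_mul_zero_pow (hK : K ⊆ Ici 0) (hμ : μ ∈ admissibleMeasures K) :
    (∀ k, 0 < moment μ k) ∨ ∀ k, moment μ k = moment μ 0 * 0 ^ k := by
  by_cases hpos : ∀ k, 0 < moment μ k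
  · exact .inl hpos
  push Not at hpos
  obtain ⟨j, hj⟩ := hpos
  have hzero : ∀ᵐ x ∂μ, x = 0 := by
    have hnonneg : ∀ᵐ x ∂μ, 0 ≤ x ^ j := by
      filter_upwards [ae_mem_of_mem_admissibleMeasures hμ] with x hx using pow_nonneg (hK hx) j
    filter_upwards [(integral_eq_zero_iff_of_nonneg_ae hnonneg (hμ.1 j)).1
      (hj.antisymm (moment_nonneg_of_subset_Ici hμ hK j))] with x hx using eq_zero_of_pow_eq_zero hx
  refine .inr fun k => ?_
  rw [moment, moment, ← integral_mul_const]
  refine integral_congr_ae ?_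
  filter_upwards [hzero] with x hx
  rw [hx, pow_zero, one_mul]

theorem HasNonnegPowerSeries.mapsTo_momentSeqs (hF : HasNonnegPowerSeries F) (hF0 : F 0 = 0)
    {K : Submonoid ℝ} (hK : MeasurableSet (K : Set ℝ)) (hK0 : (K : Set ℝ) ⊆ Ici 0) (h0 : 0 ∈ K) :
    MapsTo (entrywise F) (momentSeqs K) (momentSeqs K) := by
  rintro s ⟨ν, hν, hs⟩
  obtain rfl : s = moment ν := funext hs
  rcases moment_pos_or_eq_mul_zero_pow hK0 hν with hpos | hzero
  · obtain ⟨c, hc, hsum⟩ := hF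
    obtain ⟨σ, hσ, hmoment⟩ :=
      exists_hasSum_moment hK hK0 hν hc fun k => (hsum _ (hpos k)).summable
    exact ⟨σ, hσ, fun k => (hsum _ (hpos k)).unique (hmoment k)⟩
  · have hmass : 0 ≤ F (moment ν 0) := by
      rcases (moment_nonneg_of_subset_Ici hν hK0 0).eq_or_lt with h | h
      · rw [← h, hF0]
      · exact hF.nonneg h
    convert const_mul_pow_mem_momentSeqs (K := K) h0 hmass using 2 with k
    rcases k with _ | k
    · rw [entrywise, pow_zero, mul_one]
    · rw [entrywise, hzero, zero_pow k.succ_ne_zero, mul_zero, mul_zero, hF0]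

theorem IsOddAbsMonotonic.mapsTo_momentSeqs (hF : IsOddAbsMonotonic F) {K : Submonoid ℝ}
    (hK : MeasurableSet (K : Set ℝ)) (hK0 : (K : Set ℝ) ⊆ Ici 0) (h0 : 0 ∈ K) :
    MapsTo (entrywise F) (momentSeqs (-K : Set ℝ)) (momentSeqs (-K : Set ℝ)) := by
  obtain ⟨hodd, hseries⟩ := isOddAbsMonotonic_iff.1 hF
  exact mapsTo_momentSeqs_neg hodd (hseries.mapsTo_momentSeqs hodd.map_zero hK hK0 h0)

theorem IsOddAbsMonotonic.mapsTo_momentSeqs_Icc (hF : IsOddAbsMonotonic F) :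
    MapsTo (entrywise F) (momentSeqs (Icc (-1) 0)) (momentSeqs (Icc (-1) 0)) := by
  have hK : -(unitInterval.submonoid : Set ℝ) = Icc (-1) 0 := by
    change -Icc (0 : ℝ) 1 = _
    rw [neg_Icc, neg_zero]
  exact hK ▸ hF.mapsTo_momentSeqs measurableSet_Icc (fun _ hx => hx.1) ⟨le_rfl, zero_le_one⟩

theorem IsOddAbsMonotonic.mapsTo_momentSeqs_Iic (hF : IsOddAbsMonotonic F) :
    MapsTo (entrywise F) (momentSeqs (Iic 0)) (momentSeqs (Iic 0)) := by
  have hK : -((Subsemiring.nonneg ℝ).toSubmonoid : Set ℝ) = Iic 0 := by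
    change -Ici (0 : ℝ) = _
    rw [neg_Ici, neg_zero]
  exact hK ▸ hF.mapsTo_momentSeqs measurableSet_Ici subset_rfl (mem_Ici.2 le_rfl)

/-! ### Necessary conditions for preserving moment sequences -/

theorem riesz_moment_mul (hμ : μ ∈ admissibleMeasures K) (j : ℕ) (q : ℝ[X]) :
    riesz (fun k => moment μ (j * k)) q = ∫ x, q.eval (x ^ j) ∂μ := by
  simp only [riesz, Polynomial.eval_eq_sum, Polynomial.sum_def, ← pow_mul]
  rw [integral_finsetSum _ fun k _ => (hμ.1 _).const_mul _]
  simp only [integral_const_mul, moment]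

theorem isPositiveSeq_of_mem_momentSeqs (hs : s ∈ momentSeqs K) (j : ℕ) :
    IsPositiveSeq fun k => s (j * k) := by
  obtain ⟨μ, hμ, hsμ⟩ := hs
  intro q hq
  simp only [hsμ, riesz_moment_mul hμ]
  exact integral_nonneg fun x => hq _

theorem integral_pow_mul_one_add_sq (hμ : μ ∈ admissibleMeasures K) (j : ℕ) :
    ∫ x, x ^ j * (1 + x) ^ 2 ∂μ = moment μ j + 2 * moment μ (j + 1) + moment μ (j + 2) := by
  have hexpand (x : ℝ) : x ^ j * (1 + x) ^ 2 = x ^ j + 2 * x ^ (j + 1) + x ^ (j + 2) := by ring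
  simp only [hexpand]
  have hint : Integrable (fun x => x ^ j + 2 * x ^ (j + 1)) μ :=
    (hμ.1 j).add ((hμ.1 (j + 1)).const_mul 2)
  rw [integral_add hint (hμ.1 _), integral_add (hμ.1 _) ((hμ.1 _).const_mul _),
    integral_const_mul, moment, moment, moment]

theorem neg_eq_and_le_add_of_mapsTo
    (h : MapsTo (entrywise F) (truncMomentSeqs 4 {-1, 0}) (truncMomentSeqs 4 (Iic 0)))
    {a b : ℝ} (ha : 0 ≤ a) (hb : 0 ≤ b) : F (-a) = -F a ∧ F a ≤ F (a + b) := by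
  have hs : (fun k => a * (-1) ^ k) + (fun k => b * 0 ^ k) ∈ momentSeqs {-1, 0} :=
    add_mem_momentSeqs (const_mul_pow_mem_momentSeqs (by simp) ha)
      (const_mul_pow_mem_momentSeqs (by simp) hb)
  rw [truncMomentSeqs_eq_image, mapsTo_image_iff] at h
  obtain ⟨μ, hμ, hmoment⟩ := h hs
  have h0 : F (a + b) = moment μ 0 := by simpa [entrywise] using hmoment 0
  have h1 : F (-a) = moment μ 1 := by simpa [entrywise] using hmoment 1
  have h2 : F a = moment μ 2 := by simpa [entrywise] using hmoment 2
  have h3 : F (-a) = moment μ 3 := by simpa [entrywise, pow_succ] using hmoment 3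
  have h4 : F a = moment μ 4 := by simpa [entrywise, pow_succ] using hmoment 4
  have hnonneg {j : ℕ} (hj : Even j) :
      0 ≤ moment μ j + 2 * moment μ (j + 1) + moment μ (j + 2) := by
    rw [← integral_pow_mul_one_add_sq hμ]
    exact integral_nonneg fun x => mul_nonneg (hj.pow_nonneg x) (sq_nonneg _)
  have hnonpos : moment μ 1 + 2 * moment μ 2 + moment μ 3 ≤ 0 := by
    rw [← integral_pow_mul_one_add_sq hμ]
    refine integral_nonpos_of_ae ?_
    filter_upwards [ae_mem_of_mem_admissibleMeasures hμ] with x hx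
    exact mul_nonpos_of_nonpos_of_nonneg (by simpa using hx) (sq_nonneg _)
  have hnonneg0 := hnonneg (j := 0) (by decide)
  have hnonneg2 := hnonneg (j := 2) (by decide)
  rw [← h0, ← h1, ← h2] at hnonneg0
  rw [← h2, ← h3, ← h4] at hnonneg2
  rw [← h1, ← h2, ← h3] at hnonpos
  constructor <;> linarith

theorem isOddAbsMonotonic_of_mapsTo {u : ℝ} (hu0 : 0 < u) (hu1 : u ≠ 1)
    (h : MapsTo (entrywise F) (momentSeqs {-1, -u}) (momentSeqs univ))
    (htrunc : MapsTo (entrywise F) (truncMomentSeqs 4 {-1, 0}) (truncMomentSeqs 4 (Iic 0))) :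
    IsOddAbsMonotonic F := by
  have hodd : F.Odd := fun x => by
    rcases le_total 0 x with hx | hx
    · exact (neg_eq_and_le_add_of_mapsTo htrunc hx le_rfl).1
    · have := (neg_eq_and_le_add_of_mapsTo htrunc (neg_nonneg.2 hx) le_rfl).1
      rw [← neg_neg x, this, neg_neg, neg_neg]
  have hmono : Monotone fun x => F (max x 0) := fun x y hxy => by
    have hle : max x 0 ≤ max y 0 := max_le_max_right 0 hxy
    simpa using
      (neg_eq_and_le_add_of_mapsTo htrunc (le_max_right x 0) (sub_nonneg.2 hle)).2
  refine isOddAbsMonotonic_iff.2 ⟨hodd, ?_⟩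
  refine (hasNonnegPowerSeries_of_isPositiveSeq hmono (pow_pos hu0 2)
    (by rwa [Ne, pow_eq_one_iff_of_nonneg hu0.le two_ne_zero]) fun a b ha hb => ?_).congr
    fun x hx => by simp only [max_eq_left (mem_Ioi.1 hx).le]
  have hs : (fun k => a * (-1) ^ k) + (fun k => b * (-u) ^ k) ∈ momentSeqs {-1, -u} :=
    add_mem_momentSeqs (const_mul_pow_mem_momentSeqs (by simp) ha.le)
      (const_mul_pow_mem_momentSeqs (by simp) hb.le)
  convert! isPositiveSeq_of_mem_momentSeqs (h hs) 2 using 2 with k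
  rw [max_eq_left (by positivity)]
  simp [entrywise, pow_mul]

end Moments

end MomentTransforms

open MomentTransforms in
theorem theorem6p1_general (F : ℝ → ℝ) {u₀ : ℝ} (hu₀ : 0 < u₀) (hu₁ : u₀ ≠ 1) :
    List.TFAE [
      MapsTo (entrywise F) (momentSeqs {-1, -u₀}) (momentSeqs univ) ∧
        MapsTo (entrywise F) (truncMomentSeqs 4 {-1, 0}) (truncMomentSeqs 4 (Iic 0)),
      MapsTo (entrywise F) (momentSeqs {-1, -u₀}) (momentSeqs (Iic 0)) ∧
        MapsTo (entrywise F)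
          (truncMomentSeqs 4 {-1, 0} ∪ ⋃ u ∈ Ioo (0 : ℝ) 1, truncMomentSeqs 4 {-u})
          (truncMomentSeqs 4 (Iic 0)),
      MapsTo (entrywise F) (momentSeqs (Icc (-1) 0)) (momentSeqs (Icc (-1) 0)),
      MapsTo (entrywise F) (momentSeqs (Icc (-1) 0)) (momentSeqs (Iic 0)),
      MapsTo (entrywise F) (momentSeqs (Iic 0)) (momentSeqs (Iic 0)),
      IsOddAbsMonotonic F] := by
  tfae_have 1 → 6 := fun h => isOddAbsMonotonic_of_mapsTo hu₀ hu₁ h.1 h.2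
  tfae_have 6 → 3 := fun hF => hF.mapsTo_momentSeqs_Icc
  tfae_have 6 → 5 := fun hF => hF.mapsTo_momentSeqs_Iic
  tfae_have 3 → 4 := fun h => h.mono_right (momentSeqs_mono Icc_subset_Iic_self)
  tfae_have 4 → 6 := fun h =>
    isOddAbsMonotonic_of_mapsTo (u := 1 / 2) (by norm_num) (by norm_num)
      (h.mono (momentSeqs_mono (pair_subset (by norm_num) (by norm_num)))
        (momentSeqs_mono (subset_univ _)))
      ((mapsTo_truncMomentSeqs h 4).mono_left
        (truncMomentSeqs_mono 4 (pair_subset (by simp) (by simp))))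
  tfae_have 5 → 2 := fun h =>
    ⟨h.mono_left (momentSeqs_mono (pair_subset (by simp) (by simp [hu₀.le]))),
      (mapsTo_truncMomentSeqs h 4).mono_left <| union_subset
        (truncMomentSeqs_mono 4 (pair_subset (by simp) (by simp)))
        (iUnion₂_subset fun u hu => truncMomentSeqs_mono 4 (by simp [hu.1.le]))⟩
  tfae_have 2 → 1 := fun h =>
    ⟨h.1.mono_right (momentSeqs_mono (subset_univ _)), h.2.mono_left subset_union_left⟩
  tfae_finish

end

theorem theorem6p1 :
    (∀ (F : ℝ → ℝ) (u₀ : ℝ), u₀ ∈ Ioo (0 : ℝ) 1 →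
      List.TFAE [
        MapsTo (MomentTransforms.entrywise F)
            (MomentTransforms.momentSeqs {-1, -u₀}) (MomentTransforms.momentSeqs (Iic 0)) ∧
          MapsTo (MomentTransforms.entrywise F)
            (MomentTransforms.truncMomentSeqs 4 {-1, 0} ∪
              ⋃ u ∈ Ioo (0 : ℝ) 1, MomentTransforms.truncMomentSeqs 4 {-u})
            (MomentTransforms.truncMomentSeqs 4 (Iic 0)),
        MapsTo (MomentTransforms.entrywise F)
          (MomentTransforms.momentSeqs (Icc (-1) 0)) (MomentTransforms.momentSeqs (Icc (-1) 0)),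
        MomentTransforms.IsOddAbsMonotonic F]) ∧
    (∀ F : ℝ → ℝ,
      MapsTo (MomentTransforms.entrywise F)
          (MomentTransforms.momentSeqs (Icc (-1) 0)) (MomentTransforms.momentSeqs (Iic 0)) ↔
        MomentTransforms.IsOddAbsMonotonic F) ∧
    (∀ F : ℝ → ℝ, MomentTransforms.IsOddAbsMonotonic F → Function.Odd F) ∧
    (∃ F : ℝ → ℝ, MomentTransforms.IsOddAbsMonotonic F ∧ ¬ ContinuousAt F 0) := by
  refine ⟨fun F u₀ hu₀ => ?_, fun F => ?_, fun F hF => ?_, ?_⟩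
  · have h := theorem6p1_general F hu₀.1 hu₀.2.ne
    tfae_have 1 ↔ 3 := h.out 1 5
    tfae_have 2 ↔ 3 := h.out 2 5
    tfae_finish
  · exact (theorem6p1_general F (u₀ := 1 / 2) (by norm_num) (by norm_num)).out 3 5
  · exact (MomentTransforms.isOddAbsMonotonic_iff.1 hF).1
  · exact ⟨Real.sign, MomentTransforms.isOddAbsMonotonic_sign,
      MomentTransforms.not_continuousAt_sign⟩
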